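/- Let $p,q$ be odd primes with $p\mid q-1$, let $n\in(\mathbb Z/q)^\times$ satisfy $n^p=1$ and $n\ne 1$, and let $G=\mathbb Z_q\rtimes_n\mathbb Z_p=\langle a\rangle\rtimes\langle b\rangle$, with $bab^{-1}=a^n$. For $g\in G$ write $g=a^{g_a}b^{g_b}$, and for $m\in\mathbb Z/p$ let $[m]\in\{0,\dots,p-1\}$ be its representative. Let $0\le u<p$ and let $$\omega_u(g,h,l)=\exp\!\Big(\tfrac{2\pi i}{p^2}\,u\,[l_b]\big([g_b]+[h_b]-[g_b+h_b]\big)\Big),$$ a normalized $3$-cocycle of $G$ with values in $U(1)$. Let $\mathrm{Vec}_G^{\omega_u}$ be the category of finite-dimensional $G$-graded complex vector spaces with associator $(x\otimes y)\otimes z\mapsto\omega_u(|x|,|y|,|z|)^{-1}\,x\otimes(y\otimes z)$ on homogeneous vectors, and $\mathcal Z(\mathrm{Vec}_G^{\omega_u})$ its Drinfeld center, whose objects are equivalently representations of the twisted double $D^{\omega_u}(G)$, with braiding $c(v\otimes w)=(|v|\triangleright w)\otimes v$ and twist $\theta(v)=|v|\triangleright v$ for homogeneous $v$. Let $1\le k\le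 p-1$ and $0\le s<p$, let $\pi_k^s(b^l)=\exp\!\big(\tfrac{2\pi i}{p^2}(sp+uk)l\big)$ for $0\le l<p$ (a projective character of the centralizer $\langle b\rangle$ of $b^k$), and let $V=V(b^k,\pi_k^s)$ be the simple object of $\mathcal Z(\mathrm{Vec}_G^{\omega_u})$ induced from it. Put $\zeta=\exp\!\big(\tfrac{2\pi i}{p^2}(sp+uk)k\big)$, and let $X_k$ be the Alexander quandle $\mathbb Z/q$ with $x\triangleright y=(1-n^k)x+n^ky$. Then the twist of $V$ is $\theta_V=\zeta\cdot\mathrm{id}_V$. Moreover, for every $N\ge 1$ and every braid word $\sigma_{i_1}^{\epsilon_1}\cdots\sigma_{i_h}^{\epsilon_h}\in\mathcal B_N$, with $L$ the closure of the braid (an oriented link with the blackboard framing), the invariant of $L$ with every component colored by $V$, that is, the quantum trace in $\mathcal Z(\mathrm{Vec}_G^{\omega_u})$ of the automorphism of $V^{\otimes N}$ given by the braid, equals $$\zeta^{\,Wr(L)}\,C_{X_k}(L),$$ where $Wr(L)=\sum_j\epsilon_j$ is the writhe (the sum of the signs of the crossings) of the closed braid diagram, and $C_{X_k}(L)$ is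 the number of colorings of the arcs of that diagram by $X_k$. A coloring is a map from the arcs to $X_k$ such that at each crossing, where $x$ is the color of the over-arc and $y$, $z$ are the colors of the under-arcs to the right and to the left of the oriented over-arc, one has $z=x\triangleright y$. -/

import Mathlib

open CategoryTheory MonoidalCategory

noncomputable section

/-- A normalized `3`-cocycle on `G` with coefficients in `U(1)`. -/
structure NormalizedCocycle (G : Type) [Group G] where
  val : G → G → G → Circle
  cocycle : ∀ g h k l, val h k l * val g (h * k) l * val g h k = val (g * h) k l * val g h (k * l)
  one_left : ∀ h k, val 1 h k = 1
  one_mid : ∀ g k, val g 1 k = 1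
  one_right : ∀ g h, val g h 1 = 1

/-- Objects of `Vec_G^ω`: finite-dimensional `G`-graded complex vector spaces, each presented by a
finite homogeneous basis `ι` with degree map `deg : ι → G`. -/
structure GVec (G : Type) [Group G] (ω : NormalizedCocycle G) where
  ι : Type
  [fin : Fintype ι]
  [dec : DecidableEq ι]
  deg : ι → G

namespace GVec

attribute [instance] GVec.fin GVec.dec

variable {G : Type} [Group G] {ω : NormalizedCocycle G}

/-- Grading-preserving linear maps, as matrices: `mat i j` is the coefficient of the basis vector
`j` of `Y` in the image of the basis vector `i` of `X`. -/
@[ext]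
structure Hom (X Y : GVec G ω) where
  mat : Matrix X.ι Y.ι ℂ
  homog : ∀ i j, X.deg i ≠ Y.deg j → mat i j = 0

instance : Category (GVec G ω) where
  Hom X Y := Hom X Y
  id X :=
    { mat := 1
      homog := fun i j h => Matrix.one_apply_ne (fun e => h (congrArg X.deg e)) }
  comp {X Y Z} f g :=
    { mat := f.mat * g.mat
      homog := fun i k h => by
        rw [Matrix.mul_apply]
        refine Finset.sum_eq_zero fun j _ => ?_
        by_cases e : X.deg i = Y.deg j
        · rw [g.homog j k (fun e' => h (e.trans e')), mul_zero]
        · rw [f.homog i j e, zero_mul] }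
  id_comp f := Hom.ext (Matrix.one_mul _)
  comp_id f := Hom.ext (Matrix.mul_one _)
  assoc f g h := Hom.ext (Matrix.mul_assoc _ _ _)

@[ext]
theorem hom_ext {X Y : GVec G ω} (f g : X ⟶ Y) (h : ∀ i j, f.mat i j = g.mat i j) : f = g :=
  Hom.ext (Matrix.ext h)

theorem id_mat (X : GVec G ω) : Hom.mat (𝟙 X) = 1 := rfl

theorem comp_mat {X Y Z : GVec G ω} (f : X ⟶ Y) (g : Y ⟶ Z) :
    Hom.mat (f ≫ g) = f.mat * g.mat := rfl

/-- The isomorphism sending the basis vector `i` to `a i` times the basis vector `e i`. -/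
def monomialIso {X Y : GVec G ω} (e : X.ι ≃ Y.ι) (he : ∀ i, Y.deg (e i) = X.deg i)
    (a : X.ι → Circle) : X ≅ Y where
  hom :=
    { mat := fun i j => if e i = j then (a i : ℂ) else 0
      homog := fun i j h => if_neg (fun h' => h (by rw [← h', he])) }
  inv :=
    { mat := fun j i => if e i = j then ((a i)⁻¹ : ℂ) else 0
      homog := fun j i h => if_neg (fun h' => h (by rw [← h', he])) }
  hom_inv_id := by
    ext i j
    rw [comp_mat, id_mat, Matrix.mul_apply, Matrix.one_apply]
    simp
    grind [Circle.coe_ne_zero]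
  inv_hom_id := by
    ext i j
    rw [comp_mat, id_mat, Matrix.mul_apply, Matrix.one_apply, ← e.symm.sum_comp]
    by_cases h : i = j
    · simp [h]
    · simp [h, Ne.symm h]

theorem monomialIso_hom_mat {X Y : GVec G ω} (e : X.ι ≃ Y.ι) (he) (a) (i : X.ι) (j : Y.ι) :
    (monomialIso e he a).hom.mat i j = if e i = j then (a i : ℂ) else 0 := rfl

theorem monomialIso_inv_mat {X Y : GVec G ω} (e : X.ι ≃ Y.ι) (he) (a) (j : Y.ι) (i : X.ι) :
    (monomialIso e he a).inv.mat j i = if e i = j then ((a i)⁻¹ : ℂ) else 0 := rfl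

theorem monomialIso_comp_mat {X Y Z : GVec G ω} (e : X.ι ≃ Y.ι) (he) (a) (f : Y ⟶ Z)
    (i : X.ι) (k : Z.ι) : Hom.mat ((monomialIso e he a).hom ≫ f) i k = a i * f.mat (e i) k := by
  rw [comp_mat, Matrix.mul_apply]
  simp [monomialIso_hom_mat]

theorem comp_monomialIso_mat {X Y Z : GVec G ω} (e : Y.ι ≃ Z.ι) (he) (a) (f : X ⟶ Y)
    (i : X.ι) (k : Z.ι) :
    Hom.mat (f ≫ (monomialIso e he a).hom) i k = f.mat i (e.symm k) * a (e.symm k) := by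
  rw [comp_mat, Matrix.mul_apply, ← e.symm.sum_comp]
  simp [monomialIso_hom_mat]

/-- The tensor product: basis vectors are pairs, and degrees multiply. -/
abbrev tens (X Y : GVec G ω) : GVec G ω where
  ι := X.ι × Y.ι
  deg i := X.deg i.1 * Y.deg i.2

/-- The ground field `ℂ` in degree `1`. -/
abbrev one : GVec G ω where
  ι := Unit
  deg _ := 1

/-- The tensor product of morphisms (the Kronecker product of matrices). -/
def tensHom {X Y X' Y' : GVec G ω} (f : X ⟶ Y) (g : X' ⟶ Y') : tens X X' ⟶ tens Y Y' where
  mat i j := f.mat i.1 j.1 * g.mat i.2 j.2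
  homog i j h := by
    by_cases e : X.deg i.1 = Y.deg j.1
    · by_cases e' : X'.deg i.2 = Y'.deg j.2
      · exact absurd (congrArg₂ (· * ·) e e') h
      · rw [g.homog _ _ e', mul_zero]
    · rw [f.homog _ _ e, zero_mul]

theorem tensHom_mat {X Y X' Y' : GVec G ω} (f : X ⟶ Y) (g : X' ⟶ Y') (i : X.ι × X'.ι)
    (j : Y.ι × Y'.ι) : (tensHom f g).mat i j = f.mat i.1 j.1 * g.mat i.2 j.2 := rfl

/-- The associativity constraint `(x ⊗ y) ⊗ z ↦ ω(|x|,|y|,|z|)⁻¹ x ⊗ (y ⊗ z)`. -/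
def assoc (X Y Z : GVec G ω) : tens (tens X Y) Z ≅ tens X (tens Y Z) :=
  monomialIso (Equiv.prodAssoc X.ι Y.ι Z.ι) (fun _ => (mul_assoc _ _ _).symm)
    (fun i => (ω.val (X.deg i.1.1) (Y.deg i.1.2) (Z.deg i.2))⁻¹)

/-- The left unit constraint `1 ⊗ x ↦ x`. -/
def leftUnit (X : GVec G ω) : tens one X ≅ X :=
  monomialIso (Equiv.punitProd X.ι) (fun _ => (one_mul _).symm) (fun _ => 1)

/-- The right unit constraint `x ⊗ 1 ↦ x`. -/
def rightUnit (X : GVec G ω) : tens X one ≅ X :=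
  monomialIso (Equiv.prodPUnit X.ι) (fun _ => (mul_one _).symm) (fun _ => 1)

theorem tensHom_id (X Y : GVec G ω) : tensHom (𝟙 X) (𝟙 Y) = 𝟙 (tens X Y) := by
  ext ⟨i, i'⟩ ⟨j, j'⟩
  simp only [tensHom_mat, id_mat, Matrix.one_apply, Prod.mk.injEq]
  split_ifs <;> simp_all

theorem tensHom_comp {X₁ Y₁ Z₁ X₂ Y₂ Z₂ : GVec G ω} (f₁ : X₁ ⟶ Y₁) (f₂ : X₂ ⟶ Y₂)
    (g₁ : Y₁ ⟶ Z₁) (g₂ : Y₂ ⟶ Z₂) :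
    tensHom f₁ f₂ ≫ tensHom g₁ g₂ = tensHom (f₁ ≫ g₁) (f₂ ≫ g₂) := by
  ext i k
  rw [tensHom_mat, comp_mat, comp_mat, comp_mat, Matrix.mul_apply, Matrix.mul_apply,
    Matrix.mul_apply, Finset.sum_mul_sum, ← Finset.sum_product']
  exact Finset.sum_congr rfl fun _ _ => by rw [tensHom_mat, tensHom_mat]; ring

theorem assoc_comp_mat {X Y Z W : GVec G ω} (f : tens X (tens Y Z) ⟶ W) (x : X.ι) (y : Y.ι)
    (z : Z.ι) (w : W.ι) : Hom.mat ((assoc X Y Z).hom ≫ f) ((x, y), z) w =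
      (((ω.val (X.deg x) (Y.deg y) (Z.deg z))⁻¹ : Circle) : ℂ) * f.mat (x, (y, z)) w :=
  monomialIso_comp_mat _ _ _ _ _ _

theorem comp_assoc_mat {X Y Z W : GVec G ω} (f : W ⟶ tens (tens X Y) Z) (x : X.ι) (y : Y.ι)
    (z : Z.ι) (w : W.ι) : Hom.mat (f ≫ (assoc X Y Z).hom) w (x, (y, z)) =
      f.mat w ((x, y), z) * (((ω.val (X.deg x) (Y.deg y) (Z.deg z))⁻¹ : Circle) : ℂ) :=
  comp_monomialIso_mat _ _ _ _ _ _

theorem assoc_hom_mat (X Y Z : GVec G ω) (x x' : X.ι) (y y' : Y.ι) (z z' : Z.ι) :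
    (assoc X Y Z).hom.mat ((x, y), z) (x', (y', z')) = if x = x' ∧ y = y' ∧ z = z' then
      (((ω.val (X.deg x) (Y.deg y) (Z.deg z))⁻¹ : Circle) : ℂ) else 0 :=
  (monomialIso_hom_mat _ _ _ _ _).trans (by simp)

theorem assoc_natural {X₁ X₂ X₃ Y₁ Y₂ Y₃ : GVec G ω} (f₁ : X₁ ⟶ Y₁) (f₂ : X₂ ⟶ Y₂)
    (f₃ : X₃ ⟶ Y₃) : tensHom (tensHom f₁ f₂) f₃ ≫ (assoc Y₁ Y₂ Y₃).hom =
      (assoc X₁ X₂ X₃).hom ≫ tensHom f₁ (tensHom f₂ f₃) := by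
  ext ⟨⟨i₁, i₂⟩, i₃⟩ ⟨j₁, j₂, j₃⟩
  rw [comp_assoc_mat, assoc_comp_mat]
  simp only [tensHom_mat]
  by_cases h₁ : X₁.deg i₁ = Y₁.deg j₁
  · by_cases h₂ : X₂.deg i₂ = Y₂.deg j₂
    · by_cases h₃ : X₃.deg i₃ = Y₃.deg j₃
      · rw [h₁, h₂, h₃]; ring
      · rw [f₃.homog _ _ h₃]; ring
    · rw [f₂.homog _ _ h₂]; ring
  · rw [f₁.homog _ _ h₁]; ring

theorem leftUnit_natural {X Y : GVec G ω} (f : X ⟶ Y) :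
    tensHom (𝟙 one) f ≫ (leftUnit Y).hom = (leftUnit X).hom ≫ f := by
  ext ⟨⟨⟩, i⟩ j
  refine (comp_monomialIso_mat _ _ _ _ _ _).trans
    (Eq.trans ?_ (monomialIso_comp_mat _ _ _ _ _ _).symm)
  simp [tensHom_mat, id_mat]

theorem rightUnit_natural {X Y : GVec G ω} (f : X ⟶ Y) :
    tensHom f (𝟙 one) ≫ (rightUnit Y).hom = (rightUnit X).hom ≫ f := by
  ext ⟨i, ⟨⟩⟩ j
  refine (comp_monomialIso_mat _ _ _ _ _ _).trans
    (Eq.trans ?_ (monomialIso_comp_mat _ _ _ _ _ _).symm)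
  simp [tensHom_mat, id_mat]

theorem assoc_pentagon (W X Y Z : GVec G ω) :
    tensHom (assoc W X Y).hom (𝟙 Z) ≫ (assoc W (tens X Y) Z).hom ≫
      tensHom (𝟙 W) (assoc X Y Z).hom = (assoc (tens W X) Y Z).hom ≫ (assoc W X (tens Y Z)).hom := by
  ext ⟨⟨⟨w, x⟩, y⟩, z⟩ ⟨w', x', y', z'⟩
  have key := ω.cocycle (W.deg w) (X.deg x) (Y.deg y) (Z.deg z)
  have key' := congrArg (fun c : Circle => ((c⁻¹ : Circle) : ℂ)) key
  simp only [mul_inv, Circle.coe_mul] at key'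
  rw [assoc_comp_mat, comp_mat, Matrix.mul_apply,
    Finset.sum_eq_single (((w, (x, y)), z) : (W.ι × (X.ι × Y.ι)) × Z.ι)]
  · rw [assoc_comp_mat]
    simp only [tensHom_mat]
    rw [assoc_hom_mat, assoc_hom_mat]
    refine Eq.trans ?_ (congrArg _ (assoc_hom_mat W X (tens Y Z) w w' x x' (y, z) (y', z')).symm)
    simp only [id_mat, Matrix.one_apply, Prod.mk.injEq]
    by_cases h : w = w' ∧ x = x' ∧ y = y' ∧ z = z'
    · obtain ⟨rfl, rfl, rfl, rfl⟩ := h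
      simp only [if_true, and_self, one_mul, mul_one]
      linear_combination key'
    · grind
  · rintro ⟨⟨a, b, c⟩, d⟩ - h
    simp only [tensHom_mat]
    rw [assoc_hom_mat]
    simp only [id_mat, Matrix.one_apply]
    grind
  · intro h
    exact absurd (Finset.mem_univ _) h

theorem unit_triangle (X Y : GVec G ω) :
    (assoc X one Y).hom ≫ tensHom (𝟙 X) (leftUnit Y).hom = tensHom (rightUnit X).hom (𝟙 Y) := by
  ext ⟨⟨i, ⟨⟩⟩, i'⟩ ⟨j, j'⟩
  rw [assoc_comp_mat]
  simp [tensHom_mat, id_mat, leftUnit, rightUnit, monomialIso, ω.one_mid, Matrix.one_apply]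

/-- The monoidal category `Vec_G^ω`. -/
instance : MonoidalCategoryStruct (GVec G ω) where
  tensorObj X Y := tens X Y
  tensorHom f g := tensHom f g
  whiskerLeft X _ _ f := tensHom (𝟙 X) f
  whiskerRight f Y := tensHom f (𝟙 Y)
  tensorUnit := one
  associator := assoc
  leftUnitor := leftUnit
  rightUnitor := rightUnit

instance : MonoidalCategory (GVec G ω) := .ofTensorHom
  (id_tensorHom_id := tensHom_id)
  (id_tensorHom := fun _ {_ _} _ => rfl)
  (tensorHom_id := fun {_ _} _ _ => rfl)
  (tensorHom_comp_tensorHom := tensHom_comp)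
  (associator_naturality := assoc_natural)
  (leftUnitor_naturality := leftUnit_natural)
  (rightUnitor_naturality := rightUnit_natural)
  (pentagon := assoc_pentagon)
  (triangle := unit_triangle)

/-- The dual space, with the dual basis. -/
abbrev dual (X : GVec G ω) : GVec G ω where
  ι := X.ι
  deg i := (X.deg i)⁻¹

/-- The coevaluation `1 ↦ ∑ i, i* ⊗ i`. -/
def coev (X : GVec G ω) : one ⟶ tens (dual X) X where
  mat _ i := if i.1 = i.2 then 1 else 0
  homog _ i h := if_neg fun e => h (by
    change 1 = (X.deg i.1)⁻¹ * X.deg i.2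
    rw [e, inv_mul_cancel])

/-- The evaluation `i ⊗ j* ↦ δ_{ij} ω(|i|,|i|⁻¹,|i|)⁻¹`. -/
def ev (X : GVec G ω) : tens X (dual X) ⟶ one where
  mat i _ := if i.1 = i.2 then
    (((ω.val (X.deg i.1) (X.deg i.1)⁻¹ (X.deg i.1))⁻¹ : Circle) : ℂ) else 0
  homog i _ h := if_neg fun e => h (by
    change X.deg i.1 * (X.deg i.2)⁻¹ = 1
    rw [e, mul_inv_cancel])

theorem val_inv_mul (g : G) : ω.val g g⁻¹ g * ω.val g⁻¹ g g⁻¹ = 1 := by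
  have h := ω.cocycle g g⁻¹ g g⁻¹
  simpa [ω.one_left, ω.one_mid, ω.one_right, mul_comm] using h

theorem assoc_inv_comp_mat {X Y Z W : GVec G ω} (f : tens (tens X Y) Z ⟶ W) (x : X.ι) (y : Y.ι)
    (z : Z.ι) (w : W.ι) : Hom.mat ((assoc X Y Z).inv ≫ f) (x, (y, z)) w =
      (ω.val (X.deg x) (Y.deg y) (Z.deg z) : ℂ) * f.mat ((x, y), z) w := by
  have h := assoc_comp_mat ((assoc X Y Z).inv ≫ f) x y z w
  rw [Iso.hom_inv_id_assoc, Circle.coe_inv] at h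
  rw [h, mul_inv_cancel_left₀ (Circle.coe_ne_zero _)]

theorem zigzag (X : GVec G ω) :
    tensHom (𝟙 X) (coev X) ≫ (assoc X (dual X) X).inv ≫ tensHom (ev X) (𝟙 X) =
      (rightUnit X).hom ≫ (leftUnit X).inv := by
  ext ⟨x, ⟨⟩⟩ ⟨⟨⟩, y⟩
  refine Eq.trans ?_ (monomialIso_comp_mat _ _ _ _ _ _).symm
  rw [comp_mat, Matrix.mul_apply, Finset.sum_eq_single ((x, (x, x)) : X.ι × (X.ι × X.ι))]
  · rw [assoc_inv_comp_mat]
    simp [tensHom_mat, id_mat, coev, ev, leftUnit, monomialIso, Matrix.one_apply, eq_comm]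
    rw [mul_inv_cancel₀ (Circle.coe_ne_zero _)]
  · rintro ⟨a, b, c⟩ - h
    rw [assoc_inv_comp_mat]
    simp only [tensHom_mat, id_mat, coev, ev, Matrix.one_apply]
    grind
  · intro h
    exact absurd (Finset.mem_univ _) h

theorem zagzig (X : GVec G ω) :
    tensHom (coev X) (𝟙 (dual X)) ≫ (assoc (dual X) X (dual X)).hom ≫ tensHom (𝟙 (dual X)) (ev X) =
      (leftUnit (dual X)).hom ≫ (rightUnit (dual X)).inv := by
  ext ⟨⟨⟩, x⟩ ⟨y, ⟨⟩⟩
  refine Eq.trans ?_ (monomialIso_comp_mat _ _ _ _ _ _).symm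
  rw [comp_mat, Matrix.mul_apply, Finset.sum_eq_single (((x, x), x) : (X.ι × X.ι) × X.ι)]
  · rw [assoc_comp_mat]
    have h := congrArg (fun c : Circle => ((c⁻¹ : Circle) : ℂ)) (val_inv_mul (ω := ω) (X.deg x))
    simp only [mul_inv, Circle.coe_mul, inv_one, Circle.coe_one] at h
    simp only [tensHom_mat, id_mat, coev, ev, rightUnit, monomialIso, Matrix.one_apply]
    simp [eq_comm (a := x)]
    rw [← h, Circle.coe_inv, Circle.coe_inv, mul_comm]
  · rintro ⟨⟨a, b⟩, c⟩ - h
    rw [assoc_comp_mat]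
    simp only [tensHom_mat, id_mat, coev, ev, Matrix.one_apply]
    grind
  · intro h
    exact absurd (Finset.mem_univ _) h

/-- Every object has a left dual. -/
instance (X : GVec G ω) : HasLeftDual X where
  leftDual := dual X
  exact :=
    { coevaluation' := coev X
      evaluation' := ev X
      coevaluation_evaluation' := zigzag X
      evaluation_coevaluation' := zagzig X }

/-- The one-dimensional space in degree `g`. -/
abbrev delta (g : G) : GVec G ω where
  ι := Unit
  deg _ := g

theorem whiskerLeft_monomialIso_comp_mat {U X Y Z : GVec G ω} (e : X.ι ≃ Y.ι) (he) (a)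
    (f : tens U Y ⟶ Z) (i : U.ι) (x : X.ι) (z : Z.ι) :
    Hom.mat (tensHom (𝟙 U) (monomialIso e he a).hom ≫ f) (i, x) z = a x * f.mat (i, e x) z := by
  rw [comp_mat, Matrix.mul_apply, Finset.sum_eq_single ((i, e x) : U.ι × Y.ι)]
  · simp [tensHom_mat, id_mat, monomialIso_hom_mat]
  · rintro ⟨j, y⟩ - h
    simp only [tensHom_mat, id_mat, monomialIso_hom_mat, Matrix.one_apply]
    grind
  · intro h
    exact absurd (Finset.mem_univ _) h

theorem whiskerRight_monomialIso_comp_mat {U X Y Z : GVec G ω} (e : X.ι ≃ Y.ι) (he) (a)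
    (f : tens Y U ⟶ Z) (i : U.ι) (x : X.ι) (z : Z.ι) :
    Hom.mat (tensHom (monomialIso e he a).hom (𝟙 U) ≫ f) (x, i) z = a x * f.mat (e x, i) z := by
  rw [comp_mat, Matrix.mul_apply, Finset.sum_eq_single ((e x, i) : Y.ι × U.ι)]
  · simp [tensHom_mat, id_mat, monomialIso_hom_mat]
  · rintro ⟨y, j⟩ - h
    simp only [tensHom_mat, id_mat, monomialIso_hom_mat, Matrix.one_apply]
    grind
  · intro h
    exact absurd (Finset.mem_univ _) h

end GVec

/-- A half-braiding from a family of isomorphisms `U ⊗ X ≅ X ⊗ U`. -/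
def halfBraidingOfInv {C : Type*} [Category C] [MonoidalCategory C] {X : C}
    (γ : ∀ U, U ⊗ X ≅ X ⊗ U)
    (monoidal : ∀ U U', (γ (U ⊗ U')).hom = (α_ U U' X).hom ≫ U ◁ (γ U').hom ≫ (α_ U X U').inv ≫
      (γ U).hom ▷ U' ≫ (α_ X U U').hom)
    (naturality : ∀ {U U'} (f : U ⟶ U'), f ▷ X ≫ (γ U').hom = (γ U).hom ≫ X ◁ f) :
    HalfBraiding X where
  β U := (γ U).symm
  monoidal U U' := by
    rw [Iso.symm_hom, ← cancel_epi (γ (U ⊗ U')).hom, Iso.hom_inv_id, monoidal]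
    simp
  naturality {U U'} f := by
    rw [Iso.symm_hom, Iso.symm_hom, Iso.comp_inv_eq, Category.assoc, naturality,
      Iso.inv_hom_id_assoc]

/-- The Drinfeld center `Z(Vec_G^ω)`. An object is a graded space `V` with a natural family
`V ⊗ U ≅ U ⊗ V`; write `γ_U : U ⊗ V ≅ V ⊗ U` for the inverses. The braiding is
`c_{V,W} = γ^W_V : V ⊗ W ⟶ W ⊗ V`, which is the reverse of the braiding `γ^V_W⁻¹`. -/
def ZVec (G : Type) [Group G] (ω : NormalizedCocycle G) := Center (GVec G ω)

namespace ZVec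

variable {G : Type} [Group G] {ω : NormalizedCocycle G}

instance : Category (ZVec G ω) := inferInstanceAs (Category (Center (GVec G ω)))
instance : MonoidalCategory (ZVec G ω) := inferInstanceAs (MonoidalCategory (Center (GVec G ω)))
instance : BraidedCategory (ZVec G ω) := reverseBraiding (Center (GVec G ω))

/-- The underlying graded vector space. -/
def space (V : ZVec G ω) : GVec G ω := Sigma.fst V

/-- The underlying map of a morphism. -/
def map {V W : ZVec G ω} (f : V ⟶ W) : V.space ⟶ W.space := Center.Hom.f f

/-- The isomorphism `γ_U : U ⊗ V ≅ V ⊗ U`. -/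
def γ (V : ZVec G ω) (U : GVec G ω) : U ⊗ V.space ≅ V.space ⊗ U := ((Sigma.snd V).β U).symm

/-- The twist. On a vector `v` of degree `g` it is the action of `g`, where the action `v ↦ g ▷ v`
is read off from `γ` on the one-dimensional space `δ_g` by `1 ⊗ v ↦ (g ▷ v) ⊗ 1`. -/
def twist (V : ZVec G ω) : V.space ⟶ V.space where
  mat v w := (V.γ (GVec.delta (V.space.deg v))).hom.mat ((), v) (w, ())
  homog v w h := (V.γ (GVec.delta (V.space.deg v))).hom.homog ((), v) (w, ())
    (fun e => h (mul_right_cancel (b := V.space.deg v) e))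

/-- The quantum trace of `f : V ⟶ V`: the scalar by which
`1 ⟶ V* ⊗ V ⟶ V ⊗ V* ⟶ V ⊗ V* ⟶ 1` (coevaluation, braiding, `θ_V f` on the factor `V`,
evaluation) acts on the tensor unit. -/
def qtrace {V : ZVec G ω} (f : V ⟶ V) : ℂ :=
  GVec.Hom.mat (η_ (ᘁV.space) V.space ≫ (V.γ (ᘁV.space)).hom ≫
    ((map f ≫ V.twist) ▷ (ᘁV.space)) ≫ ε_ (ᘁV.space) V.space) () ()

end ZVec

section Braids

variable {C : Type*} [Category C] [MonoidalCategory C] [BraidedCategory C]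

/-- The left-parenthesized tensor power `((V ⊗ V) ⊗ ⋯) ⊗ V` with `N + 1` factors. -/
def leftPow (V : C) : ℕ → C
  | 0 => V
  | N + 1 => leftPow V N ⊗ V

/-- The action of the last generator of the braid group on `N + 2` strands. -/
def lastGenerator (V : C) : (N : ℕ) → (leftPow V (N + 1) ≅ leftPow V (N + 1))
  | 0 => β_ V V
  | N + 1 => α_ (leftPow V N) V V ≪≫ whiskerLeftIso (leftPow V N) (β_ V V) ≪≫
      (α_ (leftPow V N) V V).symm

/-- The action of the generator `σ_i` of the braid group on `N + 1` strands. -/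
def braidGenerator (V : C) : (N : ℕ) → Fin N → Aut (leftPow V N)
  | 0, i => i.elim0
  | N + 1, i => Fin.lastCases (motive := fun _ => Aut (leftPow V (N + 1))) (lastGenerator V N)
      (fun j => whiskerRightIso (braidGenerator V N j) V) i

/-- A braid on `N + 1` strands, as a word `σ_{i₁}^{ε₁} σ_{i₂}^{ε₂} ⋯` in the generators. -/
abbrev BraidWord (N : ℕ) := List (Fin N × ℤˣ)

/-- The operator invariant of a braid all of whose strands are colored by `V`. -/
def braidOperator (V : C) {N : ℕ} (w : BraidWord N) : Aut (leftPow V N) :=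
  (w.map fun l => braidGenerator V N l.1 ^ (l.2 : ℤ)).prod

end Braids

/-- The invariant of the closure of a braid (an oriented link, with its blackboard framing), all of
whose components are colored by `V`. -/
def linkInvariant {G : Type} [Group G] {ω : NormalizedCocycle G} (V : ZVec G ω) {N : ℕ}
    (w : BraidWord N) : ℂ :=
  ZVec.qtrace (braidOperator V w).hom

/-- The arcs and crossings of an oriented link diagram: each crossing has a sign, an over-arc, and
the two under-arcs lying to the left and to the right of the oriented over-arc. -/
structure LinkDiagram where
  Arc : Type
  Crossing : Type
  [fin : Fintype Crossing]
  sign : Crossing → ℤˣ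
  overArc : Crossing → Arc
  leftArc : Crossing → Arc
  rightArc : Crossing → Arc

namespace LinkDiagram

attribute [instance] LinkDiagram.fin

/-- The writhe: the sum of the signs of the crossings. -/
def writhe (D : LinkDiagram) : ℤ := ∑ c, (D.sign c : ℤ)

/-- The number of colorings of the arcs by a quandle, such that at each crossing the arc to the
left is `a ◃ b`, where `a` is the over-arc and `b` the arc to the right. -/
def numColorings (D : LinkDiagram) (X : Type) [Quandle X] : ℕ :=
  Nat.card {f : D.Arc → X // ∀ c, f (D.leftArc c) = Shelf.act (f (D.overArc c)) (f (D.rightArc c))}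

end LinkDiagram

/-- Adjacent segments of the closed braid diagram that lie on the same over-arc. The segment `(j, i)`
is the one in position `i` at height `j`, where the heights `0, …, w.length` go from top to bottom,
the strands run upwards, and the letter `j` of `w` lies between the heights `j` and `j + 1`. In
`σ_i` the strand starting at position `i` passes over, in `σ_i⁻¹` the one starting at `i + 1`. -/
inductive SameArc {N : ℕ} (w : BraidWord N) :
    Fin (w.length + 1) × Fin (N + 1) → Fin (w.length + 1) × Fin (N + 1) → Prop
  | close (i) : SameArc w (0, i) (Fin.last _, i)
  | straight (j : Fin w.length) (i) (h₀ : i ≠ (w.get j).1.castSucc) (h₁ : i ≠ (w.get j).1.succ) :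
      SameArc w (j.succ, i) (j.castSucc, i)
  | overPos (j : Fin w.length) (h : (w.get j).2 = 1) :
      SameArc w (j.succ, (w.get j).1.castSucc) (j.castSucc, (w.get j).1.succ)
  | overNeg (j : Fin w.length) (h : (w.get j).2 = -1) :
      SameArc w (j.succ, (w.get j).1.succ) (j.castSucc, (w.get j).1.castSucc)

/-- The diagram of the closure of a braid. -/
def closedBraid {N : ℕ} (w : BraidWord N) : LinkDiagram where
  Arc := Quot (SameArc w)
  Crossing := Fin w.length
  sign j := (w.get j).2
  overArc j := Quot.mk _ (j.succ, if (w.get j).2 = 1 then (w.get j).1.castSucc else (w.get j).1.succ)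
  leftArc j := Quot.mk _ (if (w.get j).2 = 1 then j.castSucc else j.succ, (w.get j).1.castSucc)
  rightArc j := Quot.mk _ (if (w.get j).2 = 1 then j.succ else j.castSucc, (w.get j).1.succ)

/-- The Alexander quandle `x ◃ y = (1 - t) x + t y` on a commutative ring with unit `t`. -/
def AlexanderQuandle (R : Type) [CommRing R] (_t : Rˣ) := R

instance (R : Type) [CommRing R] (t : Rˣ) : Quandle (AlexanderQuandle R t) where
  act := fun x y : R => (1 - (t : R)) * x + (t : R) * y
  self_distrib := fun {x y z : R} => by
    change ((1 - t) * x + t * ((1 - t) * y + t * z) : R) =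
      (1 - t) * ((1 - t) * x + t * y) + t * ((1 - t) * x + t * z)
    ring
  invAct := fun x y : R => ((t⁻¹ : Rˣ) : R) * (y - (1 - (t : R)) * x)
  left_inv := fun x y : R => by
    change (↑t⁻¹ * ((1 - t) * x + t * y - (1 - t) * x) : R) = y
    rw [add_sub_cancel_left, Units.inv_mul_cancel_left]
  right_inv := fun x y : R => by
    change ((1 - t) * x + t * (↑t⁻¹ * (y - (1 - t) * x)) : R) = y
    rw [Units.mul_inv_cancel_left, add_sub_cancel]
  fix := fun {x : R} => by
    change ((1 - t) * x + t * x : R) = x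
    ring

section Anyons

/-- The `2`-cochain `θ_g(x,y)` of the twisted double `D^ω(G)`. -/
def NormalizedCocycle.theta {G : Type} [Group G] (ω : NormalizedCocycle G) (g x y : G) : Circle :=
  ω.val g x y * ω.val x y ((x * y)⁻¹ * g * (x * y)) / ω.val x (x⁻¹ * g * x) y

variable {p q : ℕ} [Fact p.Prime] [Fact q.Prime]

/-- The action of `ℤ/p` on `ℤ/q` in which the generator acts as multiplication by `n`. -/
def actHom (n : (ZMod q)ˣ) (hn : n ^ p = 1) :
    Multiplicative (ZMod p) →* MulAut (Multiplicative (ZMod q)) where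
  toFun m := AddEquiv.toMultiplicative (DistribMulAction.toAddEquiv (ZMod q) (n ^ m.toAdd.val))
  map_one' := by
    ext x
    simp
  map_mul' m m' := by
    have h : n ^ (m.toAdd + m'.toAdd).val = n ^ (m.toAdd.val + m'.toAdd.val) := by
      rw [ZMod.val_add, ← pow_eq_pow_mod _ hn]
    ext x
    simp [h, pow_add, mul_smul]

/-- The group `G(q,p;n) = ℤ/q ⋊_n ℤ/p`. -/
abbrev Gqp (n : (ZMod q)ˣ) (hn : n ^ p = 1) : Type :=
  Multiplicative (ZMod q) ⋊[actHom n hn] Multiplicative (ZMod p)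

namespace Gqp

variable {n : (ZMod q)ˣ} {hn : n ^ p = 1}

/-- The element `a ^ x`. -/
def a (x : ZMod q) : Gqp n hn := SemidirectProduct.inl (Multiplicative.ofAdd x)

/-- The element `b ^ m`. -/
def b (m : ZMod p) : Gqp n hn := SemidirectProduct.inr (Multiplicative.ofAdd m)

/-- The exponent `l` in `g = a ^ l * b ^ m`. -/
def expA (g : Gqp n hn) : ZMod q := g.left.toAdd

/-- The exponent `m` in `g = a ^ l * b ^ m`. -/
def expB (g : Gqp n hn) : ZMod p := g.right.toAdd

theorem expB_mul (g h : Gqp n hn) : expB (g * h) = expB g + expB h := rfl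

theorem expB_inv (g : Gqp n hn) : expB g⁻¹ = -expB g := rfl

theorem expB_one : expB (1 : Gqp n hn) = 0 := rfl

theorem expB_a (x : ZMod q) : expB (a x : Gqp n hn) = 0 := rfl

theorem expB_b (m : ZMod p) : expB (b m : Gqp n hn) = m := rfl

theorem a_mul_b (g : Gqp n hn) : a (expA g) * b (expB g) = g := by
  ext <;> simp [a, b, expA, expB]

theorem b_comm (m m' : ZMod p) : (b m * b m' : Gqp n hn) = b m' * b m := by
  ext
  · simp [b]
  · simp [b, mul_comm]

theorem carry (i j : ZMod p) :
    ∃ e : ℤ, (i.val : ℝ) + (j.val : ℝ) - ((i + j).val : ℝ) = p * e := by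
  refine ⟨(((i.val + j.val) / p : ℕ) : ℤ), ?_⟩
  have h := Nat.mod_add_div (i.val + j.val) p
  rw [← ZMod.val_add] at h
  have h' : (((i + j).val + p * ((i.val + j.val) / p) : ℕ) : ℝ) = ((i.val + j.val : ℕ) : ℝ) := by
    rw [h]
  rw [Nat.cast_add, Nat.cast_mul, Nat.cast_add] at h'
  rw [Int.cast_natCast]
  linarith

end Gqp

open Gqp

variable (n : (ZMod q)ˣ) (hn : n ^ p = 1)

/-- The `3`-cocycle
`ω_u(g,h,k) = exp (2πi / p² * u [k_b] ([g_b] + [h_b] - [g_b + h_b]))` of `G(q,p;n)`. -/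
def msCocycle (u : ℕ) : NormalizedCocycle (Gqp n hn) where
  val g h k := Circle.exp (2 * Real.pi / p ^ 2 *
    (u * (expB k).val * ((expB g).val + (expB h).val - (expB g + expB h).val)))
  cocycle g h k l := by
    have hp : (p : ℝ) ≠ 0 := Nat.cast_ne_zero.mpr (Fact.out : p.Prime).ne_zero
    obtain ⟨e, he⟩ := carry (expB g) (expB h)
    obtain ⟨e', he'⟩ := carry (expB k) (expB l)
    simp only [expB_mul]
    rw [← Circle.exp_add, ← Circle.exp_add, ← Circle.exp_add, Circle.exp_eq_exp]
    refine ⟨u * e * e', ?_⟩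
    rw [add_assoc (expB g)]
    have hl : ((expB l).val : ℝ) = p * e' - (expB k).val + (expB k + expB l).val := by linarith
    have hh : ((expB h).val : ℝ) = p * e - (expB g).val + (expB g + expB h).val := by linarith
    push_cast
    field_simp
    rw [hl, hh]
    ring
  one_left h k := by simp [expB_one]
  one_mid g k := by simp [expB_one]
  one_right g h := by simp [expB_one]

/-- The projective character `π_k^s(b^l) = exp (2πi / p² * (s p + u k) l)`, `0 ≤ l < p`, of the
centralizer `⟨b⟩` of `b^k`. -/
def projChar (p u k s : ℕ) (l : ZMod p) : Circle :=
  Circle.exp (2 * Real.pi / p ^ 2 * ((s * p + u * k) * l.val))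

/-- The graded space of `V(b^k,π_k^s)`: its basis vector `|x⟩`, `x ∈ ℤ/q`, corresponds to the
representative `a^x` of `G / ⟨b⟩` and has degree `a^x b^k a^{-x}`. -/
abbrev anyonSpace (u k : ℕ) : GVec (Gqp n hn) (msCocycle n hn u) where
  ι := ZMod q
  deg x := a x * b k * (a x)⁻¹

/-- The coefficient of the action of `g` on `|x⟩` in the induced representation `V(b^k,π_k^s)`:
with `g a^x = a^y s'` and `s' ∈ ⟨b⟩`, `g` sends `|x⟩` to
`θ_h(g,a^x) θ_h(a^y,s')⁻¹ π_k^s(s') |y⟩`, where `h = a^y b^k a^{-y}`. -/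
def actCoeff (u k s : ℕ) (g : Gqp n hn) (x : ZMod q) : Circle :=
  let y := expA (g * a x)
  let h := (anyonSpace n hn u k).deg y
  (msCocycle n hn u).theta h g (a x) * ((msCocycle n hn u).theta h (a y) (b (expB (g * a x))))⁻¹ *
    projChar p u k s (expB (g * a x))

/-- The permutation `x ↦ y` of `ℤ/q` given by `g a^x ∈ a^y ⟨b⟩`. -/
def actPerm (g : Gqp n hn) : Equiv.Perm (ZMod q) where
  toFun x := expA (g * a x)
  invFun x := expA (g⁻¹ * a x)
  left_inv x := by
    simp [expA, a]
  right_inv x := by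
    simp [expA, a]

variable {n hn}

theorem actPerm_mul (g g' : Gqp n hn) (x : ZMod q) :
    actPerm n hn (g * g') x = actPerm n hn g (actPerm n hn g' x) := by
  simp [actPerm, expA, a]
  ring

theorem deg_actPerm (u k : ℕ) (g : Gqp n hn) (x : ZMod q) :
    (anyonSpace n hn u k).deg (actPerm n hn g x) * g = g * (anyonSpace n hn u k).deg x := by
  have h := a_mul_b (g * a x)
  change a (expA (g * a x)) * b k * (a (expA (g * a x)))⁻¹ * g = g * (a x * b k * (a x)⁻¹)
  have h1 : (a (expA (g * a x)))⁻¹ * g = b (expB (g * a x)) * (a x)⁻¹ := by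
    rw [inv_mul_eq_iff_eq_mul, ← mul_assoc, h, mul_inv_cancel_right]
  rw [mul_assoc _ _ g, h1, mul_assoc (a _) (b _), ← mul_assoc (b _) (b _), b_comm,
    mul_assoc (b _) (b _), ← mul_assoc, h]
  group

theorem expB_conj (x : ZMod q) (m : ZMod p) : expB (a x * b m * (a x)⁻¹ : Gqp n hn) = m := by
  rw [expB_mul, expB_mul, expB_inv, expB_a, neg_zero, add_zero, zero_add, expB_b]

theorem val_of_left (u : ℕ) (g h k : Gqp n hn) (e : expB g = 0) :
    (msCocycle n hn u).val g h k = 1 := by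
  simp [msCocycle, e]

theorem val_of_mid (u : ℕ) (g h k : Gqp n hn) (e : expB h = 0) :
    (msCocycle n hn u).val g h k = 1 := by
  simp [msCocycle, e]

theorem val_of_right (u : ℕ) (g h k : Gqp n hn) (e : expB k = 0) :
    (msCocycle n hn u).val g h k = 1 := by
  simp [msCocycle, e]

theorem theta_of_right (u : ℕ) (h g r : Gqp n hn) (e : expB r = 0) :
    (msCocycle n hn u).theta h g r = 1 := by
  rw [NormalizedCocycle.theta, val_of_right u h g r e, val_of_mid u g r _ e, val_of_right u g _ r e,
    one_mul, div_one]

theorem theta_of_mid (u : ℕ) (h r g : Gqp n hn) (e : expB r = 0) :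
    (msCocycle n hn u).theta h r g = 1 := by
  rw [NormalizedCocycle.theta, val_of_mid u h r g e, val_of_left u r g _ e, val_of_left u r _ g e,
    one_mul, div_one]

theorem actCoeff_eq (u k s : ℕ) (g : Gqp n hn) (x : ZMod q) :
    actCoeff n hn u k s g x = projChar p u k s (expB g) := by
  have h : expB (g * a x) = expB g := by rw [expB_mul, expB_a, add_zero]
  simp only [actCoeff]
  rw [theta_of_right u _ g _ (expB_a x), theta_of_mid u _ _ _ (expB_a _), inv_one, one_mul, one_mul,
    h]

theorem projChar_mul (u k s : ℕ) (l m : ZMod p) (g h : Gqp n hn) (x : ZMod q) (hg : expB g = l)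
    (hh : expB h = m) : projChar p u k s l * projChar p u k s m =
      (msCocycle n hn u).val g h ((anyonSpace n hn u k).deg x) * projChar p u k s (l + m) := by
  have hp : (p : ℝ) ≠ 0 := Nat.cast_ne_zero.mpr (Fact.out : p.Prime).ne_zero
  obtain ⟨e, he⟩ := carry l m
  simp only [projChar, msCocycle, expB_conj, hg, hh]
  rw [← Circle.exp_add, ← Circle.exp_add, Circle.exp_eq_exp]
  have hk : (((k : ZMod p).val : ℕ) : ℝ) = k - p * (k / p : ℕ) := by
    rw [ZMod.val_natCast, eq_sub_iff_add_eq]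
    exact_mod_cast Nat.mod_add_div k p
  refine ⟨s * e + u * (k / p : ℕ) * e, ?_⟩
  have hl : (l.val : ℝ) = p * e - m.val + (l + m).val := by linarith
  rw [hk, hl]
  rw [Int.cast_add, Int.cast_mul, Int.cast_mul, Int.cast_mul, Int.cast_natCast, Int.cast_natCast,
    Int.cast_natCast]
  field_simp
  ring

/-- The isomorphism `γ_U : U ⊗ V ≅ V ⊗ U`, `u ⊗ |x⟩ ↦ (|u| ▷ |x⟩) ⊗ u`. -/
def anyonGamma (u k s : ℕ) (U : GVec (Gqp n hn) (msCocycle n hn u)) :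
    GVec.tens U (anyonSpace n hn u k) ≅ GVec.tens (anyonSpace n hn u k) U :=
  GVec.monomialIso
    { toFun := fun i => (actPerm n hn (U.deg i.1) i.2, i.1)
      invFun := fun i => (i.2, (actPerm n hn (U.deg i.2)).symm i.1)
      left_inv := fun _ => Prod.ext rfl (Equiv.symm_apply_apply _ _)
      right_inv := fun _ => Prod.ext (Equiv.apply_symm_apply _ _) rfl }
    (fun i => deg_actPerm u k (U.deg i.1) i.2)
    (fun i => actCoeff n hn u k s (U.deg i.1) i.2)

theorem gamma_hom_mat (u k s : ℕ) (U : GVec (Gqp n hn) (msCocycle n hn u)) (i j : U.ι)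
    (x y : ZMod q) : (anyonGamma u k s U).hom.mat (i, x) (y, j) =
      if actPerm n hn (U.deg i) x = y ∧ i = j then (projChar p u k s (expB (U.deg i)) : ℂ) else 0 := by
  refine (GVec.monomialIso_hom_mat _ _ _ _ _).trans ?_
  rw [actCoeff_eq]
  exact if_congr Prod.mk_inj rfl rfl

theorem gamma_comp_mat (u k s : ℕ) {U Z : GVec (Gqp n hn) (msCocycle n hn u)}
    (f : GVec.tens (anyonSpace n hn u k) U ⟶ Z) (i : U.ι) (x : ZMod q) (z : Z.ι) :
    GVec.Hom.mat ((anyonGamma u k s U).hom ≫ f) (i, x) z =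
      projChar p u k s (expB (U.deg i)) * f.mat (actPerm n hn (U.deg i) x, i) z := by
  refine (GVec.monomialIso_comp_mat _ _ _ _ _ _).trans ?_
  rw [actCoeff_eq]
  rfl

theorem whiskerLeft_gamma_comp_mat (u k s : ℕ) {U U' Z : GVec (Gqp n hn) (msCocycle n hn u)}
    (f : GVec.tens U (GVec.tens (anyonSpace n hn u k) U') ⟶ Z) (i : U.ι) (i' : U'.ι) (x : ZMod q)
    (z : Z.ι) :
    GVec.Hom.mat (GVec.tensHom (𝟙 U) (anyonGamma u k s U').hom ≫ f) (i, (i', x)) z =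
      projChar p u k s (expB (U'.deg i')) * f.mat (i, (actPerm n hn (U'.deg i') x, i')) z := by
  refine (GVec.whiskerLeft_monomialIso_comp_mat _ _ _ _ _ _ _).trans ?_
  rw [actCoeff_eq]
  rfl

theorem whiskerRight_gamma_comp_mat (u k s : ℕ) {U U' Z : GVec (Gqp n hn) (msCocycle n hn u)}
    (f : GVec.tens (GVec.tens (anyonSpace n hn u k) U) U' ⟶ Z) (i : U.ι) (i' : U'.ι) (x : ZMod q)
    (z : Z.ι) :
    GVec.Hom.mat (GVec.tensHom (anyonGamma u k s U).hom (𝟙 U') ≫ f) ((i, x), i') z =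
      projChar p u k s (expB (U.deg i)) * f.mat ((actPerm n hn (U.deg i) x, i), i') z := by
  refine (GVec.whiskerRight_monomialIso_comp_mat _ _ _ _ _ _ _).trans ?_
  rw [actCoeff_eq]
  rfl

theorem gamma_tens (u k s : ℕ) (U U' : GVec (Gqp n hn) (msCocycle n hn u)) :
    (anyonGamma u k s (GVec.tens U U')).hom =
      (GVec.assoc U U' (anyonSpace n hn u k)).hom ≫
        GVec.tensHom (𝟙 U) (anyonGamma u k s U').hom ≫
          (GVec.assoc U (anyonSpace n hn u k) U').inv ≫
            GVec.tensHom (anyonGamma u k s U).hom (𝟙 U') ≫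
              (GVec.assoc (anyonSpace n hn u k) U U').hom := by
  ext ⟨⟨i, i'⟩, x⟩ ⟨y, j, j'⟩
  rw [gamma_hom_mat, GVec.assoc_comp_mat, whiskerLeft_gamma_comp_mat, GVec.assoc_inv_comp_mat,
    whiskerRight_gamma_comp_mat, GVec.assoc_hom_mat, actPerm_mul]
  have key := projChar_mul u k s (expB (U.deg i)) (expB (U'.deg i')) (U.deg i) (U'.deg i') x rfl rfl
  have h1 : (msCocycle n hn u).val (U.deg i)
      ((anyonSpace n hn u k).deg (actPerm n hn (U'.deg i') x)) (U'.deg i') =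
      (msCocycle n hn u).val ((anyonSpace n hn u k).deg
        (actPerm n hn (U.deg i) (actPerm n hn (U'.deg i') x))) (U.deg i) (U'.deg i') := by
    simp only [msCocycle, expB_conj, add_comm]
  rw [h1, expB_mul]
  have key' := congrArg (fun c : Circle => (c : ℂ)) key
  simp only [Circle.coe_mul] at key'
  simp only [Prod.mk.injEq]
  split_ifs with h
  · rw [Circle.coe_inv, Circle.coe_inv]
    have hne := Circle.coe_ne_zero ((msCocycle n hn u).val (U.deg i) (U'.deg i')
      ((anyonSpace n hn u k).deg x))
    have hne' := Circle.coe_ne_zero ((msCocycle n hn u).val ((anyonSpace n hn u k).deg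
        (actPerm n hn (U.deg i) (actPerm n hn (U'.deg i') x))) (U.deg i) (U'.deg i'))
    field_simp
    linear_combination -key'
  · simp

theorem gamma_natural (u k s : ℕ) {U U' : GVec (Gqp n hn) (msCocycle n hn u)} (f : U ⟶ U') :
    GVec.tensHom f (𝟙 (anyonSpace n hn u k)) ≫ (anyonGamma u k s U').hom =
      (anyonGamma u k s U).hom ≫ GVec.tensHom (𝟙 (anyonSpace n hn u k)) f := by
  ext ⟨i, x⟩ ⟨y, j⟩
  rw [gamma_comp_mat, GVec.comp_mat, Matrix.mul_apply,
    Finset.sum_eq_single ((j, x) : U'.ι × (anyonSpace n hn u k).ι)]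
  · rw [gamma_hom_mat, GVec.tensHom_mat, GVec.tensHom_mat, GVec.id_mat, Matrix.one_apply,
      Matrix.one_apply]
    by_cases h : U.deg i = U'.deg j
    · rw [h]
      simp [mul_comm]
    · rw [f.homog i j h]
      simp
  · rintro ⟨j', x'⟩ - h
    rw [gamma_hom_mat, GVec.tensHom_mat, GVec.id_mat, Matrix.one_apply]
    grind
  · intro h
    exact absurd (Finset.mem_univ _) h

variable (n hn)

/-- The half-braiding of `V(b^k,π_k^s)`. -/
def anyonHalfBraiding (u k s : ℕ) : HalfBraiding (anyonSpace n hn u k) :=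
  halfBraidingOfInv (fun U => anyonGamma u k s U) (fun U U' => gamma_tens u k s U U')
    (fun f => gamma_natural u k s f)

/-- The simple object `V(b^k,π_k^s)` of `Z(Vec_G^{ω_u})`, `G = G(q,p;n)`. -/
def anyon (u k s : ℕ) : ZVec (Gqp n hn) (msCocycle n hn u) :=
  Sigma.mk (anyonSpace n hn u k) (anyonHalfBraiding n hn u k s)

end Anyons

end

/-! The cocycle depends only on exponents of b, and every basis vector |x⟩ of V has degree a^x b^k
a^{-x}, whose b-exponent is k. This degree therefore acts on each |y⟩ with the same coefficient
π(b^k) = ζ, and it moves y to (1 - n^k)x + n^k y = x ▷ y. So the braiding of V with itself is ζ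
times the permutation matrix (x, y) ↦ (x ▷ y, x). The associators around a generator contribute
equal cocycle values that cancel, so a braid word acts as ζ to the writhe times the matrix of
`braidPerm` (`braidOperator_isMonomial`). The twist is the diagonal case, where x ▷ x = x.

Two general facts turn this into the link invariant. For every object of the center the quantum
trace is the ordinary matrix trace (`ZVec.qtrace_eq_trace`): moving past the dual acts by g⁻¹, the
twist acts by g, and the evaluation carries exactly the cocycle value needed for these to cancel.
The trace of a permutation matrix counts fixed points, and the color vectors fixed by `braidPerm`
are the colorings of the closed diagram (`numColorings_closedBraid`). -/

noncomputable section

/-! ### Colorings of a closed braid as fixed points of a permutation -/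

/-- The permutation of colors of `N + 1` strands induced by the generator `σ_i`: the colors `x`, `y`
in positions `i`, `i + 1` become `x ◃ y`, `x`. -/
def crossingPerm (X : Type*) [Rack X] {N : ℕ} (i : Fin N) : Equiv.Perm (Fin (N + 1) → X) where
  toFun x := Function.update (Function.update x i.castSucc (Shelf.act (x i.castSucc) (x i.succ)))
    i.succ (x i.castSucc)
  invFun x := Function.update (Function.update x i.castSucc (x i.succ))
    i.succ (Rack.invAct (x i.succ) (x i.castSucc))
  left_inv x := by
    ext j
    have := (Fin.castSucc_lt_succ (i := i)).ne
    by_cases h : j = i.succ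
    · subst h; simp [this]
    · by_cases h' : j = i.castSucc
      · subst h'; simp [this]
      · simp [h, h']
  right_inv x := by
    ext j
    have := (Fin.castSucc_lt_succ (i := i)).ne
    by_cases h : j = i.succ
    · subst h; simp [this]
    · by_cases h' : j = i.castSucc
      · subst h'; simp [this]
      · simp [h, h']

/-- The permutation of colors of the strands induced by a braid word. -/
def braidPerm (X : Type*) [Rack X] {N : ℕ} (w : BraidWord N) : Equiv.Perm (Fin (N + 1) → X) :=
  (w.map fun l => crossingPerm X l.1 ^ (l.2 : ℤ)).prod

theorem braidPerm_cons (X : Type*) [Rack X] {N : ℕ} (l : Fin N × ℤˣ) (w : BraidWord N) :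
    braidPerm X (l :: w) = crossingPerm X l.1 ^ (l.2 : ℤ) * braidPerm X w := by
  simp [braidPerm]

/-- The three conditions are the local rules at a positive crossing: the strands not involved, the
over-strand (the gluings of `SameArc`), and the quandle relation for the under-strand. A negative
crossing obeys the same rules with `x` and `y` exchanged. -/
theorem crossingPerm_apply_eq_iff (X : Type*) [Rack X] {N : ℕ} (i : Fin N) (x y : Fin (N + 1) → X) :
    crossingPerm X i x = y ↔ (∀ j, j ≠ i.castSucc → j ≠ i.succ → x j = y j) ∧
      x i.castSucc = y i.succ ∧ y i.castSucc = Shelf.act (x i.castSucc) (x i.succ) := by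
  have hne := (Fin.castSucc_lt_succ (i := i)).ne
  constructor
  · rintro rfl
    refine ⟨fun j h h' => ?_, ?_, ?_⟩ <;> simp [crossingPerm, *]
  · rintro ⟨h, h1, h2⟩
    ext j
    by_cases h' : j = i.succ
    · subst h'; simp [crossingPerm, h1]
    · by_cases h'' : j = i.castSucc
      · subst h''; simp [crossingPerm, hne, h2]
      · simp [crossingPerm, h', h'', h]

theorem crossingPerm_zpow_neg_one_apply_eq_iff (X : Type*) [Rack X] {N : ℕ} (i : Fin N)
    (x y : Fin (N + 1) → X) :
    (crossingPerm X i ^ (-1 : ℤ)) x = y ↔ crossingPerm X i y = x := by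
  rw [zpow_neg_one, Equiv.Perm.inv_eq_iff_eq, eq_comm]

/-- A coloring is determined by its bottom row: passing upwards through a letter applies its
crossing permutation, so the row at height `j` is the image of the bottom row under the letters from
`j` on. The closing arcs identify the top row with the bottom row, which is the fixed point
condition. -/
theorem numColorings_closedBraid (X : Type) [Quandle X] {N : ℕ} (w : BraidWord N) :
    (closedBraid w).numColorings X = Nat.card {x : Fin (N + 1) → X // braidPerm X w x = x} := by
  have hstep (j : Fin w.length) (x : Fin (N + 1) → X) : braidPerm X (w.drop j) x =
      (crossingPerm X (w.get j).1 ^ ((w.get j).2 : ℤ)) (braidPerm X (w.drop (j + 1)) x) := by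
    rw [List.drop_eq_getElem_cons j.2, braidPerm_cons]
    rfl
  have hunits (j : Fin w.length) := Int.units_eq_one_or (w.get j).2
  have hne : (-1 : ℤˣ) ≠ 1 := by decide
  have hrow (f : (closedBraid w).Arc → X)
      (hf : ∀ c, f ((closedBraid w).leftArc c) =
        Shelf.act (f ((closedBraid w).overArc c)) (f ((closedBraid w).rightArc c))) (j : ℕ)
      (hj : j ≤ w.length) :
      braidPerm X (w.drop j) (fun i => f (Quot.mk _ (Fin.last _, i))) =
        fun i => f (Quot.mk _ (⟨j, Nat.lt_succ_of_le hj⟩, i)) := by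
    induction hj using Nat.decreasingInduction with
    | self => simp [braidPerm]; rfl
    -- The induction climbs from the bottom of the diagram, since the last letter acts first.
    | of_succ j hj ih =>
      rw [hstep ⟨j, hj⟩, ih]
      have hc := hf ⟨j, hj⟩
      simp only [closedBraid] at hc
      rcases hunits ⟨j, hj⟩ with h | h
      · rw [h, Units.val_one, zpow_one, crossingPerm_apply_eq_iff]
        refine ⟨fun i h0 h1 => congrArg f (Quot.sound (.straight ⟨j, hj⟩ i h0 h1)),
          congrArg f (Quot.sound (.overPos ⟨j, hj⟩ h)), ?_⟩
        simp only [h, if_true] at hc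
        exact hc
      · rw [h, Units.val_neg, Units.val_one, crossingPerm_zpow_neg_one_apply_eq_iff,
          crossingPerm_apply_eq_iff]
        refine ⟨fun i h0 h1 => congrArg f (Quot.sound (.straight ⟨j, hj⟩ i h0 h1)).symm,
          congrArg f (Quot.sound (.overNeg ⟨j, hj⟩ h)).symm, ?_⟩
        -- The over-arc is recorded below the crossing, whereas the inverse permutation refers to
        -- its color above it; `overNeg` identifies the two.
        have e := congrArg f (Quot.sound (SameArc.overNeg ⟨j, hj⟩ h))
        simp only [h, hne, if_false] at hc
        exact hc.trans (by rw [e]; rfl)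
  refine Nat.card_congr (Equiv.ofBijective (fun f => ⟨fun i => f.1 (Quot.mk _ (Fin.last _, i)), ?_⟩)
    ⟨?_, ?_⟩)
  · refine (hrow f.1 f.2 0 (Nat.zero_le _)).trans (funext fun i => ?_)
    exact congrArg f.1 (Quot.sound (.close i))
  · intro f g hfg
    refine Subtype.ext (funext fun c => ?_)
    induction c using Quot.ind with | _ c =>
    obtain ⟨⟨j, hj⟩, i⟩ := c
    have h1 := congrFun (hrow f.1 f.2 j (Nat.le_of_lt_succ hj)) i
    have h2 := congrFun (hrow g.1 g.2 j (Nat.le_of_lt_succ hj)) i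
    have h3 := congrArg Subtype.val hfg
    dsimp only at h1 h2 h3
    rw [← h1, ← h2, h3]
  · rintro ⟨x, hx⟩
    -- Conversely, the rows generated by a fixed point satisfy the gluing and coloring rules at
    -- every letter; the clauses treat idle strands, positive crossings and negative crossings.
    have hall (j : Fin w.length) : (∀ i, i ≠ (w.get j).1.castSucc → i ≠ (w.get j).1.succ →
          braidPerm X (w.drop (j + 1)) x i = braidPerm X (w.drop j) x i) ∧
        ((w.get j).2 = 1 → braidPerm X (w.drop (j + 1)) x (w.get j).1.castSucc =
          braidPerm X (w.drop j) x (w.get j).1.succ ∧ braidPerm X (w.drop j) x (w.get j).1.castSucc =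
          Shelf.act (braidPerm X (w.drop (j + 1)) x (w.get j).1.castSucc)
            (braidPerm X (w.drop (j + 1)) x (w.get j).1.succ)) ∧
        ((w.get j).2 = -1 → braidPerm X (w.drop (j + 1)) x (w.get j).1.succ =
          braidPerm X (w.drop j) x (w.get j).1.castSucc ∧
          braidPerm X (w.drop (j + 1)) x (w.get j).1.castSucc =
          Shelf.act (braidPerm X (w.drop (j + 1)) x (w.get j).1.succ)
            (braidPerm X (w.drop j) x (w.get j).1.succ)) := by
      have h1 := (hstep j x).symm
      rcases hunits j with h | h
      · rw [h, Units.val_one, zpow_one, crossingPerm_apply_eq_iff] at h1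
        exact ⟨h1.1, fun _ => h1.2, fun h' => absurd (h'.symm.trans h) hne⟩
      · rw [h, Units.val_neg, Units.val_one, crossingPerm_zpow_neg_one_apply_eq_iff,
          crossingPerm_apply_eq_iff] at h1
        refine ⟨fun i h0 h1' => (h1.1 i h0 h1').symm, fun h' => absurd (h.symm.trans h') hne,
          fun _ => ⟨h1.2.1.symm, ?_⟩⟩
        rw [← h1.2.1]
        exact h1.2.2
    refine ⟨⟨Quot.lift (fun c => braidPerm X (w.drop c.1) x c.2) ?_, ?_⟩, ?_⟩
    · rintro _ _ (i | ⟨j, i, h0, h1⟩ | ⟨j, h⟩ | ⟨j, h⟩)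
      -- The closing arcs are the only place where well-definedness needs `x` to be fixed.
      · simp [hx]
        simp [braidPerm]
      · exact (hall j).1 i h0 h1
      · exact ((hall j).2.1 h).1
      · exact ((hall j).2.2 h).1
    · intro j
      simp only [closedBraid]
      rcases hunits j with h | h
      · simp only [h, if_true]
        exact ((hall j).2.1 h).2
      · simp only [h, hne, if_false]
        exact ((hall j).2.2 h).2
    · refine Subtype.ext (funext fun i => ?_)
      simp [braidPerm]

/-! ### The quantum trace in the center is the matrix trace -/

section HalfBraiding

variable {C : Type*} [Category C] [MonoidalCategory C] {X : C} (b : HalfBraiding X)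

/-- In a braided category the braiding with the unit is forced by the unitors; applied in `Center
C`, this gives the component of the half-braiding at the unit. -/
theorem HalfBraiding.inv_unit : (b.β (𝟙_ C)).inv = (λ_ X).hom ≫ (ρ_ X).inv := by
  let V : Center C := ⟨X, b⟩
  have h := congrArg Center.Hom.f (braiding_tensorUnit_right (C := Center C) V)
  replace h : (b.β (𝟙_ C)).hom = (ρ_ X).hom ≫ (λ_ V).inv.f := h
  rw [Center.leftUnitor_inv_f] at h
  replace h : (b.β (𝟙_ C)).hom = (ρ_ X).hom ≫ (λ_ X).inv := h
  rw [← cancel_epi (b.β (𝟙_ C)).hom, Iso.hom_inv_id, h]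
  simp

theorem HalfBraiding.inv_naturality {U U' : C} (f : U ⟶ U') :
    f ▷ X ≫ (b.β U').inv = (b.β U).inv ≫ X ◁ f := by
  rw [Iso.comp_inv_eq, Category.assoc, b.naturality, Iso.inv_hom_id_assoc]

theorem HalfBraiding.inv_tensor (U U' : C) :
    (b.β (U ⊗ U')).inv = (α_ U U' X).hom ≫ U ◁ (b.β U').inv ≫ (α_ U X U').inv ≫
      (b.β U).inv ▷ U' ≫ (α_ X U U').hom := by
  rw [← cancel_epi (b.β (U ⊗ U')).hom, Iso.hom_inv_id, b.monoidal]
  simp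

end HalfBraiding

namespace GVec

variable {G : Type} [Group G] {ω : NormalizedCocycle G}

theorem comp_tens_mat {X Y Y' Z : GVec G ω} (f : X ⟶ tens Y Y') (g : tens Y Y' ⟶ Z) (x : X.ι)
    (z : Z.ι) : Hom.mat (f ≫ g) x z = ∑ y, ∑ y', f.mat x (y, y') * g.mat (y, y') z := by
  rw [comp_mat, Matrix.mul_apply]
  exact Fintype.sum_prod_type _

end GVec

namespace ZVec

variable {G : Type} [Group G] {ω : NormalizedCocycle G}

theorem γ_unit (V : ZVec G ω) :
    (V.γ (𝟙_ (GVec G ω))).hom = (λ_ V.space).hom ≫ (ρ_ V.space).inv :=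
  HalfBraiding.inv_unit (Sigma.snd V)

theorem γ_naturality (V : ZVec G ω) {U U' : GVec G ω} (f : U ⟶ U') :
    f ▷ V.space ≫ (V.γ U').hom = (V.γ U).hom ≫ V.space ◁ f :=
  HalfBraiding.inv_naturality (Sigma.snd V) f

theorem γ_tensor (V : ZVec G ω) (U U' : GVec G ω) :
    (V.γ (U ⊗ U')).hom = (α_ U U' V.space).hom ≫ U ◁ (V.γ U').hom ≫ (α_ U V.space U').inv ≫
      (V.γ U).hom ▷ U' ≫ (α_ V.space U U').hom :=
  HalfBraiding.inv_tensor (Sigma.snd V) U U'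

/-- The matrix of the action of `g`. -/
def act (V : ZVec G ω) (g : G) (v w : V.space.ι) : ℂ :=
  (V.γ (GVec.delta g)).hom.mat ((), v) (w, ())

theorem act_eq_zero (V : ZVec G ω) (g : G) (v w : V.space.ι)
    (h : g * V.space.deg v ≠ V.space.deg w * g) : V.act g v w = 0 :=
  (V.γ (GVec.delta g)).hom.homog ((), v) (w, ()) h

/-- By naturality along the map from a one-dimensional space onto the basis vector `i`, a
half-braiding is determined by its components at the spaces `GVec.delta g`. -/
theorem γ_mat (V : ZVec G ω) (U : GVec G ω) (i j : U.ι) (v w : V.space.ι) :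
    (V.γ U).hom.mat (i, v) (w, j) = if i = j then V.act (U.deg i) v w else 0 := by
  let f : GVec.delta (ω := ω) (U.deg i) ⟶ U :=
    { mat := fun _ j => if i = j then 1 else 0
      homog := fun _ j h => if_neg fun e => h (congrArg U.deg e) }
  have h := congrArg (fun m => GVec.Hom.mat m ((), v) (w, j)) (V.γ_naturality f)
  change GVec.Hom.mat (GVec.tensHom f (𝟙 V.space) ≫ (V.γ U).hom) ((), v) (w, j) =
    GVec.Hom.mat ((V.γ _).hom ≫ GVec.tensHom (𝟙 V.space) f) ((), v) (w, j) at h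
  rw [GVec.comp_mat, GVec.comp_mat, Matrix.mul_apply, Matrix.mul_apply,
    Finset.sum_eq_single ((i, v) : U.ι × V.space.ι)] at h
  · refine Eq.trans ?_ (h.trans ?_)
    · simp [GVec.tensHom_mat, GVec.id_mat, f]
    · refine (Finset.sum_eq_single ((w, ()) : V.space.ι × Unit) ?_ ?_).trans ?_
      · rintro ⟨a, ⟨⟩⟩ - hab
        simp only [GVec.tensHom_mat, GVec.id_mat, Matrix.one_apply]
        grind
      · intro h
        exact absurd (Finset.mem_univ _) h
      · simp [GVec.tensHom_mat, GVec.id_mat, f, act]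
  · rintro ⟨a, b⟩ - hab
    simp only [GVec.tensHom_mat, GVec.id_mat, Matrix.one_apply, f]
    grind
  · intro h
    exact absurd (Finset.mem_univ _) h

theorem act_one (V : ZVec G ω) (v w : V.space.ι) : V.act 1 v w = if v = w then 1 else 0 := by
  have h := congrArg (fun m => GVec.Hom.mat m ((), v) (w, ())) V.γ_unit
  refine h.trans ?_
  change GVec.Hom.mat ((GVec.leftUnit V.space).hom ≫ (GVec.rightUnit V.space).inv) ((), v) (w, ()) = _
  refine (GVec.monomialIso_comp_mat _ _ _ _ _ _).trans ?_
  simp [GVec.rightUnit, GVec.monomialIso, eq_comm]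

/-- This is the hexagon `γ_tensor` read in coordinates: the action is multiplicative up to the three
cocycle values of the associators. -/
theorem act_mul (V : ZVec G ω) (g h : G) (v w : V.space.ι) :
    V.act (g * h) v w = ((ω.val g h (V.space.deg v) : ℂ))⁻¹ * ∑ x, V.act h v x *
      (ω.val g (V.space.deg x) h * V.act g x w * (ω.val (V.space.deg w) g h : ℂ)⁻¹) := by
  -- The tensor product has a single basis vector, of degree `g * h`, so its half-braiding is the
  -- action of `g * h`.
  have e := V.γ_mat (GVec.delta g ⊗ GVec.delta h) ((), ()) ((), ()) v w
  rw [if_pos rfl] at e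
  refine e.symm.trans ?_
  rw [γ_tensor]
  refine (GVec.assoc_comp_mat _ _ _ _ _).trans ?_
  rw [Circle.coe_inv]
  refine congrArg _ ?_
  change GVec.Hom.mat (GVec.tensHom (𝟙 (GVec.delta g)) (V.γ (GVec.delta h)).hom ≫
    (GVec.assoc (GVec.delta g) V.space (GVec.delta h)).inv ≫
    GVec.tensHom (V.γ (GVec.delta g)).hom (𝟙 (GVec.delta h)) ≫
    (GVec.assoc V.space (GVec.delta g) (GVec.delta h)).hom) ((), ((), v)) (w, ((), ())) = _
  rw [GVec.comp_tens_mat]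
  refine (Fintype.sum_unique _).trans ?_
  refine (Fintype.sum_prod_type _).trans ?_
  refine Finset.sum_congr rfl fun x _ => (Fintype.sum_unique _).trans ?_
  have e1 := GVec.assoc_inv_comp_mat (GVec.tensHom (V.γ (GVec.delta g)).hom (𝟙 (GVec.delta h)) ≫
    (GVec.assoc V.space (GVec.delta g) (GVec.delta h)).hom) () x () (w, ((), ()))
  have e2 := GVec.comp_assoc_mat (GVec.tensHom (V.γ (GVec.delta g)).hom (𝟙 (GVec.delta h)))
    w () () (((), x), ())
  refine congrArg₂ _ (one_mul _) (e1.trans ?_)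
  rw [e2, mul_assoc, Circle.coe_inv]
  exact congrArg _ (congrArg (· * _) (mul_one _))

/-- Apply `act_mul` to g⁻¹g = 1, with g the degree of `v`. Only indices of degree g contribute, and
there two of the three cocycle values cancel, leaving the factor of the evaluation. -/
theorem sum_act_mul_act_inv (V : ZVec G ω) (v w : V.space.ι) :
    ∑ i, V.act (V.space.deg v) v i * V.act (V.space.deg i)⁻¹ i w *
      (ω.val (V.space.deg i) (V.space.deg i)⁻¹ (V.space.deg i) : ℂ)⁻¹ =
        if v = w then 1 else 0 := by
  set g := V.space.deg v with hg
  have h := V.act_mul g⁻¹ g v w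
  rw [inv_mul_cancel, act_one] at h
  rw [h, Finset.mul_sum]
  refine Finset.sum_congr rfl fun i _ => ?_
  by_cases hi : V.space.deg i = g
  · rw [hi]
    by_cases hw : V.space.deg w = g
    · rw [hw, ← hg]
      have := Circle.coe_ne_zero (ω.val g⁻¹ g g)
      field_simp
    · rw [V.act_eq_zero g⁻¹ i w (by rw [hi, inv_mul_cancel, ne_comm, ne_eq, mul_inv_eq_one]; exact hw)]
      ring
  · rw [V.act_eq_zero g v i (by rw [← hg, ne_eq, mul_left_inj, eq_comm]; exact hi)]
    ring

/-- The inverse action from the braiding with the dual undoes the twist, so only the diagonal of `f`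
is left. -/
theorem qtrace_eq_trace (V : ZVec G ω) (f : V ⟶ V) : qtrace f = (map f).mat.trace := by
  -- The coevaluation creates the index `i`, the braiding with the dual sends it to `w`, `f` sends
  -- `w` to `w'`, and the twist must return `w'` to `i` for the evaluation to be nonzero.
  have h : qtrace f = ∑ i, ∑ w, V.act (V.space.deg i)⁻¹ i w * (∑ w', (map f).mat w w' *
      V.act (V.space.deg w') w' i) *
      (ω.val (V.space.deg i) (V.space.deg i)⁻¹ (V.space.deg i) : ℂ)⁻¹ := by
    change GVec.Hom.mat (GVec.coev V.space ≫ (V.γ (GVec.dual V.space)).hom ≫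
      GVec.tensHom (map f ≫ V.twist) (𝟙 (GVec.dual V.space)) ≫ GVec.ev V.space) () () = _
    rw [GVec.comp_tens_mat]
    refine Finset.sum_congr rfl fun i _ => (Finset.sum_eq_single i ?_ ?_).trans ?_
    · intro j _ hj
      rw [GVec.coev]
      simp [hj.symm]
    · simp
    rw [GVec.comp_tens_mat]
    simp only [GVec.coev, if_true, one_mul]
    refine Finset.sum_congr rfl fun w _ => (Finset.sum_eq_single i ?_ ?_).trans ?_
    · intro j _ hj
      rw [γ_mat, if_neg hj.symm, zero_mul]
    · simp
    rw [γ_mat, if_pos rfl, mul_assoc, GVec.comp_tens_mat]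
    refine congrArg _ ?_
    refine (Finset.sum_eq_single i ?_ ?_).trans ((Finset.sum_eq_single i ?_ ?_).trans ?_)
    · intro j _ hj
      refine Finset.sum_eq_zero fun j' _ => ?_
      simp only [GVec.tensHom_mat, GVec.id_mat, GVec.ev, Matrix.one_apply]
      grind
    · simp
    · intro j _ hj
      simp only [GVec.tensHom_mat, GVec.id_mat, GVec.ev, Matrix.one_apply]
      grind
    · simp
    rw [GVec.tensHom_mat, GVec.comp_mat, Matrix.mul_apply]
    simp [GVec.id_mat, GVec.ev]
    rfl
  rw [h, Finset.sum_comm, Matrix.trace]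
  refine Finset.sum_congr rfl fun w _ => ?_
  have h' (w' : V.space.ι) := V.sum_act_mul_act_inv w' w
  simp_rw [Finset.mul_sum, Finset.sum_mul]
  rw [Finset.sum_comm]
  -- For fixed `w` and `w'` the sum over `i` is the one in `sum_act_mul_act_inv`, which forces `w' =
  -- w`.
  have h'' (w' : V.space.ι) : ∑ i, V.act (V.space.deg i)⁻¹ i w * ((map f).mat w w' *
      V.act (V.space.deg w') w' i) *
      (ω.val (V.space.deg i) (V.space.deg i)⁻¹ (V.space.deg i) : ℂ)⁻¹ =
      (map f).mat w w' * if w' = w then 1 else 0 := by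
    rw [← h', Finset.mul_sum]
    exact Finset.sum_congr rfl fun i _ => by ring
  rw [Finset.sum_congr rfl fun w' _ => h'' w']
  simp

end ZVec

/-! ### Crossings on an appended strand, and coordinates of the structure maps -/

theorem ite_zero_congr {R : Type*} [Zero R] {P Q : Prop} {_ : Decidable P} {_ : Decidable Q}
    {x y : R} (h : P ↔ Q) (hxy : x = y) : (if P then x else 0) = if Q then y else 0 :=
  if_congr h hxy rfl

/-- Color vectors grow by `Fin.snoc` as the left-parenthesized tensor power grows by a right factor,
so this mirrors the whiskering step in `braidGenerator`. -/
theorem crossingPerm_castSucc_snoc (X : Type*) [Rack X] {N : ℕ} (i : Fin N) (a : Fin (N + 1) → X)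
    (x : X) : crossingPerm X i.castSucc (Fin.snoc a x) =
      (Fin.snoc (crossingPerm X i a) x : Fin (N + 2) → X) := by
  simp only [crossingPerm, Equiv.coe_fn_mk, ← Fin.castSucc_succ, Fin.snoc_castSucc, Fin.snoc_update]

theorem crossingPerm_last_snoc (X : Type*) [Rack X] {N : ℕ} (a : Fin (N + 1) → X) (x : X) :
    crossingPerm X (Fin.last N) (Fin.snoc a x) =
      (Fin.snoc (Function.update a (Fin.last N) (Shelf.act (a (Fin.last N)) x)) (a (Fin.last N)) :
        Fin (N + 2) → X) := by
  have h : (Fin.last N).castSucc ≠ Fin.last (N + 1) := (Fin.castSucc_lt_last _).ne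
  simp only [crossingPerm, Equiv.coe_fn_mk, Fin.succ_last, Fin.snoc_castSucc, Fin.snoc_last,
    Function.update_comm h, Fin.update_snoc_last, Fin.snoc_update]

theorem crossingPerm_last_snoc_const_eq_iff (X : Type*) [Rack X] (x y x' y' : X) :
    crossingPerm X (Fin.last 0) (Fin.snoc (fun _ => x) y) =
      (Fin.snoc (fun _ => x') y' : Fin 2 → X) ↔ Shelf.act x y = x' ∧ x = y' := by
  rw [crossingPerm_last_snoc, Fin.snoc_inj]
  refine and_congr_left' ⟨fun h => ?_, fun h => funext fun i => ?_⟩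
  · simpa using congrFun h (Fin.last 0)
  · rw [Subsingleton.elim (α := Fin 1) i (Fin.last 0), Function.update_self, h]

theorem crossingPerm_last_snoc_snoc_eq_iff (X : Type*) [Rack X] {N : ℕ} (c c' : Fin (N + 1) → X)
    (x y x' y' : X) :
    crossingPerm X (Fin.last (N + 1)) (Fin.snoc (Fin.snoc c x : Fin (N + 2) → X) y) =
      (Fin.snoc (Fin.snoc c' x' : Fin (N + 2) → X) y' : Fin (N + 3) → X) ↔
      c = c' ∧ Shelf.act x y = x' ∧ x = y' := by
  rw [crossingPerm_last_snoc, Fin.update_snoc_last, Fin.snoc_last, Fin.snoc_inj, Fin.snoc_inj,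
    and_assoc]

theorem GVec.comp_assoc_inv_mat {G : Type} [Group G] {ω : NormalizedCocycle G} {X Y Z W : GVec G ω}
    (f : W ⟶ tens X (tens Y Z)) (x : X.ι) (y : Y.ι) (z : Z.ι) (w : W.ι) :
    Hom.mat (f ≫ (assoc X Y Z).inv) w ((x, y), z) =
      f.mat w (x, (y, z)) * (ω.val (X.deg x) (Y.deg y) (Z.deg z) : ℂ) := by
  have h := comp_assoc_mat (f ≫ (assoc X Y Z).inv) x y z w
  rw [Category.assoc, Iso.inv_hom_id, Category.comp_id, Circle.coe_inv] at h
  rw [h, inv_mul_cancel_right₀ (Circle.coe_ne_zero _)]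

section Braids

variable {C : Type*} [Category C] [MonoidalCategory C] [BraidedCategory C]

theorem braidGenerator_last (V : C) (N : ℕ) :
    braidGenerator V (N + 1) (Fin.last N) = lastGenerator V N := Fin.lastCases_last

theorem braidGenerator_castSucc (V : C) (N : ℕ) (i : Fin N) :
    braidGenerator V (N + 1) i.castSucc = whiskerRightIso (braidGenerator V N i) V :=
  Fin.lastCases_castSucc i

end Braids

namespace ZVec

variable {G : Type} [Group G] {ω : NormalizedCocycle G}

theorem map_comp_mat {U V W : ZVec G ω} (f : U ⟶ V) (g : V ⟶ W) :
    (map (f ≫ g)).mat = (map f).mat * (map g).mat := rfl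

theorem map_id_mat (V : ZVec G ω) : (map (𝟙 V)).mat = 1 := rfl

/-- The braiding is the reverse of the one on `Center`, so it is the inverse of the half-braiding of
`W`. -/
theorem map_braiding (V W : ZVec G ω) : map (β_ V W).hom = (W.γ V.space).hom := by
  change Center.Hom.f (BraidedCategory.braiding (C := Center (GVec G ω)) W V).inv = _
  refine (IsIso.inv_eq_of_hom_inv_id (f := ((Sigma.snd W).β V.space).hom) ?_)
  exact Iso.hom_inv_id _

theorem map_associator_inv (U V W : ZVec G ω) :
    map (α_ U V W).inv = (GVec.assoc U.space V.space W.space).inv :=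
  Center.associator_inv_f (C := GVec G ω) U V W

end ZVec

/-! ### Braid operators on V as scaled permutation matrices -/

open Gqp
variable {p q : ℕ} [Fact p.Prime] [Fact q.Prime] (n : (ZMod q)ˣ) (hn : n ^ p = 1) (u k s : ℕ)

instance (R : Type) [CommRing R] (t : Rˣ) [DecidableEq R] : DecidableEq (AlexanderQuandle R t) :=
  inferInstanceAs (DecidableEq R)

instance (R : Type) [CommRing R] (t : Rˣ) [Fintype R] : Fintype (AlexanderQuandle R t) :=
  inferInstanceAs (Fintype R)

theorem AlexanderQuandle.act_eq (R : Type) [CommRing R] (t : Rˣ) (x y : R) :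
    Shelf.act (α := AlexanderQuandle R t) x y = ((1 - (t : R)) * x + (t : R) * y : R) := rfl

/-- Since b^k a^z = a^{n^k z} b^k, the product is a^{x + n^k (y - x)} b^k. This is where the
Alexander quandle appears. -/
theorem expA_conj_mul_a (x y : ZMod q) :
    expA (a x * b k * (a x)⁻¹ * a y : Gqp n hn) =
      (1 - ((n ^ k : (ZMod q)ˣ) : ZMod q)) * x + ((n ^ k : (ZMod q)ˣ) : ZMod q) * y := by
  -- The action is defined through the representative of k modulo p; n^p = 1 makes the choice
  -- irrelevant.
  have h : (n : ZMod q) ^ (k % p) = n ^ k := by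
    simpa using congrArg Units.val (pow_eq_pow_mod k hn).symm
  simp [expA, a, b]
  simp [actHom, h, Units.smul_def]
  ring

theorem act_deg_anyonSpace (x y : ZMod q) :
    actPerm n hn ((anyonSpace n hn u k).deg x) y =
      Shelf.act (α := AlexanderQuandle (ZMod q) (n ^ k)) x y :=
  (expA_conj_mul_a n hn k x y).trans (AlexanderQuandle.act_eq _ _ _ _).symm

theorem projChar_expB_deg (x : ZMod q) :
    projChar p u k s (expB ((anyonSpace n hn u k).deg x)) = projChar p u k s k := by
  rw [expB_conj]

/-- The basis of `V ⊗ ⋯ ⊗ V` is indexed by the colors of the strands. -/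
def leftPowEquiv : (N : ℕ) →
    (leftPow (anyon n hn u k s) N).space.ι ≃ (Fin (N + 1) → AlexanderQuandle (ZMod q) (n ^ k))
  | 0 => (Equiv.funUnique (Fin 1) (ZMod q)).symm
  | N + 1 => ((leftPowEquiv N).prodCongr (Equiv.refl (ZMod q))).trans
      -- The swap is needed because `Fin.snocEquiv` expects the last entry as the first component.
      ((Equiv.prodComm _ _).trans (Fin.snocEquiv fun _ => AlexanderQuandle (ZMod q) (n ^ k)))

/-- In the bases `leftPowEquiv`, `f` is `c` times the permutation matrix of `σ`. -/
def IsMonomial (N : ℕ) (f : leftPow (anyon n hn u k s) N ⟶ leftPow (anyon n hn u k s) N)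
    (σ : Equiv.Perm (Fin (N + 1) → AlexanderQuandle (ZMod q) (n ^ k))) (c : ℂ) : Prop :=
  ∀ z z', (ZVec.map f).mat z z' =
    if σ (leftPowEquiv n hn u k s N z) = leftPowEquiv n hn u k s N z' then c else 0

variable {n hn u k s}

theorem IsMonomial.id (N : ℕ) : IsMonomial n hn u k s N (𝟙 _) 1 1 := fun z z' => by
  simp [ZVec.map_id_mat, Matrix.one_apply]

/-- The order `τ * σ` reflects that morphisms compose diagrammatically while permutations compose as
functions. -/
theorem IsMonomial.comp {N : ℕ} {f g : leftPow (anyon n hn u k s) N ⟶ leftPow (anyon n hn u k s) N}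
    {σ τ c d} (hf : IsMonomial n hn u k s N f σ c) (hg : IsMonomial n hn u k s N g τ d) :
    IsMonomial n hn u k s N (f ≫ g) (τ * σ) (c * d) := fun z z' => by
  rw [ZVec.map_comp_mat, Matrix.mul_apply, ← (leftPowEquiv n hn u k s N).symm.sum_comp,
    Finset.sum_eq_single (σ (leftPowEquiv n hn u k s N z))]
  · simp only [hf _ _, hg _ _, Equiv.apply_symm_apply, if_true, Equiv.Perm.mul_apply, mul_ite,
      mul_zero]
    exact ite_zero_congr Iff.rfl rfl
  · intro y _ hy
    simp [hf _ _, hy.symm]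
  · simp

theorem IsMonomial.inv {N : ℕ} {f : Aut (leftPow (anyon n hn u k s) N)} {σ c} (hc : c ≠ 0)
    (hf : IsMonomial n hn u k s N f.hom σ c) : IsMonomial n hn u k s N f.inv σ⁻¹ c⁻¹ := fun z z' => by
  -- Row `σ⁻¹ z` of `f.hom` has its only nonzero entry, `c`, in column `z`; so this row of the
  -- identity `f.hom ≫ f.inv = 𝟙` isolates row `z` of the inverse.
  have h := congrArg (fun g => (ZVec.map g).mat ((leftPowEquiv n hn u k s N).symm
    (σ⁻¹ (leftPowEquiv n hn u k s N z))) z') f.hom_inv_id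
  simp only [ZVec.map_comp_mat, ZVec.map_id_mat] at h
  rw [Matrix.mul_apply, Finset.sum_eq_single z] at h
  · rw [hf, if_pos (by simp), Matrix.one_apply, mul_comm, ← eq_div_iff hc] at h
    rw [h]
    simp only [Equiv.symm_apply_eq]
    split_ifs <;> simp
  · intro y _ hy
    rw [hf, if_neg (by simpa using hy.symm), zero_mul]
  · simp

theorem γ_anyon_mat (U : GVec (Gqp n hn) (msCocycle n hn u)) (i j : U.ι) (x y : ZMod q) :
    ((anyon n hn u k s).γ U).hom.mat (i, x) (y, j) =
      if actPerm n hn (U.deg i) x = y ∧ i = j then (projChar p u k s (expB (U.deg i)) : ℂ) else 0 :=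
  gamma_hom_mat u k s U i j x y

theorem braiding_anyon_mat (x y x' y' : AlexanderQuandle (ZMod q) (n ^ k)) :
    (ZVec.map (β_ (anyon n hn u k s) (anyon n hn u k s)).hom).mat (x, y) (x', y') =
      if Shelf.act x y = x' ∧ x = y' then (projChar p u k s k : ℂ) else 0 := by
  rw [ZVec.map_braiding]
  refine (γ_anyon_mat _ _ _ _ _).trans ?_
  refine ite_zero_congr (and_congr_left' ?_) ?_
  · exact Eq.congr_left (act_deg_anyonSpace n hn u k x y)
  · exact congrArg _ (projChar_expB_deg n hn u k s x)

/-- All degrees of basis vectors have b-exponent k, so the cocycle cannot tell them apart; hence the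
associators before and after a crossing cancel. -/
theorem val_deg_anyonSpace_eq (g : Gqp n hn) (x y x' y' : ZMod q) :
    (msCocycle n hn u).val g ((anyonSpace n hn u k).deg x) ((anyonSpace n hn u k).deg y) =
      (msCocycle n hn u).val g ((anyonSpace n hn u k).deg x') ((anyonSpace n hn u k).deg y') := by
  simp only [msCocycle, expB_conj]

theorem lastGenerator_succ_mat {N : ℕ} (z z' : (leftPow (anyon n hn u k s) N).space.ι)
    (x y x' y' : AlexanderQuandle (ZMod q) (n ^ k)) :
    (ZVec.map (lastGenerator (anyon n hn u k s) (N + 1)).hom).mat ((z, x), y) ((z', x'), y') =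
      if z = z' ∧ Shelf.act x y = x' ∧ x = y' then (projChar p u k s k : ℂ) else 0 := by
  have h : ZVec.map (lastGenerator (anyon n hn u k s) (N + 1)).hom =
      (GVec.assoc (leftPow (anyon n hn u k s) N).space (anyon n hn u k s).space
        (anyon n hn u k s).space).hom ≫
      GVec.tensHom (𝟙 _) (ZVec.map (β_ (anyon n hn u k s) (anyon n hn u k s)).hom) ≫
      (GVec.assoc (leftPow (anyon n hn u k s) N).space (anyon n hn u k s).space
        (anyon n hn u k s).space).inv := by
    rw [← ZVec.map_associator_inv]
    rfl
  rw [h]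
  refine (GVec.assoc_comp_mat _ _ _ _ _).trans ?_
  rw [Circle.coe_inv]
  refine (congrArg _ ((GVec.comp_assoc_inv_mat _ _ _ _ _).trans (congrArg (· * _)
    (congrArg₂ (· * ·) (Matrix.one_apply) (braiding_anyon_mat x y x' y'))))).trans ?_
  by_cases hz : z = z'
  · subst hz
    rw [if_pos rfl, one_mul]
    -- The first associator contributes ω⁻¹ at the incoming colors and the second ω at the outgoing
    -- ones; these are the same value.
    have hω : (msCocycle n hn u).val ((leftPow (anyon n hn u k s) N).space.deg z)
        ((anyon n hn u k s).space.deg x) ((anyon n hn u k s).space.deg y) =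
      (msCocycle n hn u).val ((leftPow (anyon n hn u k s) N).space.deg z)
        ((anyon n hn u k s).space.deg x') ((anyon n hn u k s).space.deg y') :=
      val_deg_anyonSpace_eq _ x y x' y'
    rw [hω, mul_comm]
    refine (mul_inv_cancel_right₀ (Circle.coe_ne_zero _) _).trans ?_
    simp
  · simp [hz]

theorem whiskerRight_isMonomial {N : ℕ}
    {f : leftPow (anyon n hn u k s) N ⟶ leftPow (anyon n hn u k s) N} {i : Fin N} {c}
    (hf : IsMonomial n hn u k s N f (crossingPerm _ i) c) :
    IsMonomial n hn u k s (N + 1) (f ▷ anyon n hn u k s) (crossingPerm _ i.castSucc) c := by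
  rintro ⟨z, x⟩ ⟨z', x'⟩
  refine (congrArg₂ (· * ·) (hf z z') (Matrix.one_apply (i := x) (j := x'))).trans ?_
  refine (ite_zero_mul_ite_zero _ _ _ _).trans (ite_zero_congr (Iff.trans ?_
    (Eq.congr_left (crossingPerm_castSucc_snoc (AlexanderQuandle (ZMod q) (n ^ k)) i (leftPowEquiv n hn u k s N z) x)).symm) (mul_one _))
  exact (Fin.snoc_inj (α := fun _ => AlexanderQuandle (ZMod q) (n ^ k))).symm

theorem lastGenerator_isMonomial (N : ℕ) :
    IsMonomial n hn u k s (N + 1) (lastGenerator (anyon n hn u k s) N).hom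
      (crossingPerm _ (Fin.last N)) (projChar p u k s k) := by
  cases N with
  | zero =>
    rintro ⟨x, y⟩ ⟨x', y'⟩
    exact (braiding_anyon_mat x y x' y').trans
      (ite_zero_congr (crossingPerm_last_snoc_const_eq_iff (AlexanderQuandle (ZMod q) (n ^ k))
        x y x' y').symm rfl)
  | succ N =>
    rintro ⟨⟨z, x⟩, y⟩ ⟨⟨z', x'⟩, y'⟩
    refine (lastGenerator_succ_mat z z' x y x' y').trans (ite_zero_congr (Iff.trans ?_
      (crossingPerm_last_snoc_snoc_eq_iff (AlexanderQuandle (ZMod q) (n ^ k))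
        (leftPowEquiv n hn u k s N z)
        (leftPowEquiv n hn u k s N z') x y x' y').symm) rfl)
    exact and_congr_left' (leftPowEquiv n hn u k s N).apply_eq_iff_eq.symm

theorem braidGenerator_isMonomial (N : ℕ) (i : Fin N) :
    IsMonomial n hn u k s N (braidGenerator (anyon n hn u k s) N i).hom (crossingPerm _ i)
      (projChar p u k s k) := by
  induction N with
  | zero => exact i.elim0
  | succ N ih =>
    induction i using Fin.lastCases with
    | last =>
      rw [braidGenerator_last]
      exact lastGenerator_isMonomial N
    | cast i =>
      rw [braidGenerator_castSucc]
      exact whiskerRight_isMonomial (ih i)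

/-- Scalars multiply along the word, each letter contributing ζ to the power of its sign, so their
product is ζ to the writhe. -/
theorem braidOperator_isMonomial {N : ℕ} (w : BraidWord N) :
    IsMonomial n hn u k s N (braidOperator (anyon n hn u k s) w).hom (braidPerm _ w)
      ((projChar p u k s k : ℂ) ^ (closedBraid w).writhe) := by
  have hw : (closedBraid w).writhe = (w.map fun l => (l.2 : ℤ)).sum := by
    rw [← Fin.sum_univ_fun_getElem]
    rfl
  rw [hw]
  clear hw
  induction w with
  | nil => exact IsMonomial.id N
  | cons l w ih =>
    have hc := Circle.coe_ne_zero (projChar p u k s k)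
    have hl : IsMonomial n hn u k s N (braidGenerator (anyon n hn u k s) N l.1 ^ (l.2 : ℤ)).hom
        (crossingPerm _ l.1 ^ (l.2 : ℤ)) ((projChar p u k s k : ℂ) ^ (l.2 : ℤ)) := by
      rcases Int.units_eq_one_or l.2 with h | h
      · simpa [h] using braidGenerator_isMonomial N l.1
      · rw [h, Units.val_neg, Units.val_one, zpow_neg_one, zpow_neg_one, zpow_neg_one]
        exact (braidGenerator_isMonomial N l.1).inv hc
    rw [braidPerm_cons, List.map_cons, List.sum_cons, zpow_add₀ hc, mul_comm]
    -- Multiplication in `Aut` is reversed composition, so the tail of the word acts before its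
    -- head, as in `braidPerm`.
    exact ih.comp hl

/-! ### The link invariant and the twist -/

theorem linkInvariant_anyon {N : ℕ} (w : BraidWord N) :
    linkInvariant (anyon n hn u k s) w = (projChar p u k s k : ℂ) ^ (closedBraid w).writhe *
      ((closedBraid w).numColorings (AlexanderQuandle (ZMod q) (n ^ k)) : ℂ) := by
  rw [linkInvariant, ZVec.qtrace_eq_trace, numColorings_closedBraid, Matrix.trace,
    ← (leftPowEquiv n hn u k s N).symm.sum_comp]
  simp only [Matrix.diag_apply, braidOperator_isMonomial w _ _, Equiv.apply_symm_apply]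
  rw [Finset.sum_ite, Finset.sum_const_zero, add_zero, Finset.sum_const, nsmul_eq_mul, mul_comm,
    Nat.card_eq_fintype_card, Fintype.card_subtype]

theorem twist_anyon : (anyon n hn u k s).twist.mat = (projChar p u k s k : ℂ) • 1 := by
  ext x y
  refine (γ_anyon_mat _ _ _ _ _).trans ?_
  rw [Matrix.smul_apply, Matrix.one_apply, smul_eq_mul, mul_ite, mul_one, mul_zero]
  refine ite_zero_congr ?_ (congrArg _ (projChar_expB_deg n hn u k s x))
  rw [and_iff_left rfl]
  -- A vector acted on by its own degree stays on its line because the quandle operation is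
  -- idempotent.
  exact Eq.congr_left ((act_deg_anyonSpace n hn u k x x).trans
    (Quandle.fix (α := AlexanderQuandle (ZMod q) (n ^ k))))

end

theorem mainTheorem4 (p q : ℕ) [Fact p.Prime] [Fact q.Prime] (hp : Odd p) (hq : Odd q)
    (hpq : p ∣ q - 1) (n : (ZMod q)ˣ) (hn : n ^ p = 1) (hn1 : n ≠ 1)
    (u s k : ℕ) (hu : u < p) (hs : s < p) (hk0 : 0 < k) (hkp : k < p)
    (ζ : ℂ) (hζ : ζ = Complex.exp (2 * Real.pi * Complex.I / p ^ 2 * ((s * p + u * k) * k))) :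
    (anyon n hn u k s).twist.mat = ζ • 1 ∧
    ∀ (N : ℕ) (w : BraidWord N),
      linkInvariant (anyon n hn u k s) w =
        ζ ^ (closedBraid w).writhe *
          ((closedBraid w).numColorings (AlexanderQuandle (ZMod q) (n ^ k)) : ℂ) := by
  -- The character is evaluated at the residue class of k, whose representative is k itself because
  -- k < p.
  have h : ζ = projChar p u k s k := by
    rw [hζ, projChar, Circle.coe_exp, ZMod.val_natCast_of_lt hkp]
    push_cast
    ring_nf
  rw [h]
  exact ⟨twist_anyon, fun N w => linkInvariant_anyon w⟩
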